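/- Let $p$ be an odd prime and let $s(p)$ denote the smallest positive integer $s$ with $p \mid 2^s-1$, i.e. the multiplicative order of $2$ modulo $p$. Let $C\subseteq \mathbb{F}_2^{2p+2}$ be a binary linear self-dual code ($C=C^\perp$ with respect to the standard inner product) of length $2p+2$ and minimum distance greater than $4$. Let $\mathrm{Aut}(C)\le S_{2p+2}$ be the group of all coordinate permutations that map $C$ onto itself, and suppose that every element of order $2$ of $\mathrm{Aut}(C)$ acts without fixed points on the $2p+2$ coordinates. (a) If $s(p)$ is even, then $\mathrm{Aut}(C)$ contains no element of order $2p$. (b) If $C$ is doubly even (all codewords have weight divisible by $4$) and $p\not\equiv -1 \pmod 8$, then $\mathrm{Aut}(C)$ contains no element of order $2p$. -/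

import Mathlib

/-- A binary linear code of length `n`: a subspace of `𝔽₂ⁿ`. -/
abbrev BinaryCode (n : ℕ) : Type := Submodule (ZMod 2) (Fin n → ZMod 2)

namespace BinaryCode

/-- The dual code: all vectors orthogonal to `C` for the standard inner product. -/
def dual {n : ℕ} (C : BinaryCode n) : BinaryCode n where
  carrier := {v | ∀ c ∈ C, v ⬝ᵥ c = 0}
  add_mem' := by
    intro a b ha hb c hc
    rw [add_dotProduct, ha c hc, hb c hc, add_zero]
  zero_mem' := by
    intro c _
    exact zero_dotProduct c
  smul_mem' := by
    intro r a ha c hc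
    rw [smul_dotProduct, ha c hc, smul_zero]

/-- `C` is self-dual if it equals its dual code. -/
def IsSelfDual {n : ℕ} (C : BinaryCode n) : Prop := C = C.dual

/-- `C` is doubly even if all its codewords have (Hamming) weight divisible by `4`. -/
def IsDoublyEven {n : ℕ} (C : BinaryCode n) : Prop := ∀ c ∈ C, 4 ∣ hammingNorm c

/-- The minimum distance: the smallest Hamming distance between two distinct codewords
(with value `0` if the code has only one codeword). -/
noncomputable def minDist {n : ℕ} (C : BinaryCode n) : ℕ :=
  sInf {d | ∃ u ∈ C, ∃ v ∈ C, u ≠ v ∧ hammingDist u v = d}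

/-- The automorphism group of a binary code: the coordinate permutations that preserve it. -/
def aut {n : ℕ} (C : BinaryCode n) : Subgroup (Equiv.Perm (Fin n)) where
  carrier := {σ | ∀ c : Fin n → ZMod 2, c ∘ σ ∈ C ↔ c ∈ C}
  mul_mem' := by
    intro σ τ hσ hτ c
    exact (hτ (c ∘ σ)).trans (hσ c)
  one_mem' := by
    intro c
    exact Iff.rfl
  inv_mem' := by
    intro σ hσ c
    have h := hσ (c ∘ ⇑σ⁻¹)
    have e : (c ∘ ⇑σ⁻¹) ∘ ⇑σ = c := by
      funext i
      simp
    rw [e] at h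
    exact h.symm

end BinaryCode

/-- The smallest positive integer `s` such that `p ∣ 2 ^ s - 1`. -/
noncomputable def orderOfTwo (p : ℕ) : ℕ := sInf {s | 0 < s ∧ p ∣ 2 ^ s - 1}

/-! Since `g ^ p` has no fixed point, `g` of order `2p` has one `2p`-cycle and one `2`-cycle. By
self-duality, a vector orthogonal to every codeword is a codeword, so each part exhibits one of
forbidden weight.

(a) Even order makes `-1` a power of `2` modulo `p`. For a codeword `c`, `c + c ∘ g ^ 2` vanishes on
the `2`-cycle; folded modulo `p` it gives `u` in `𝔽₂[ℤ/p]` with `u(x) u(x⁻¹) = 0`. As `u(x⁻¹)` is a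
Frobenius power of `u`, `u = 0`. Hence the word supported on `x, g²x, gᵖx, gᵖ⁺²x` lies in `C`.

(b) If `p ≡ 1` modulo `4`, half the long cycle plus one point of the short one is a codeword of
weight `p + 1`, not divisible by `4`. Otherwise `p ≡ 3` modulo `8`, where `2` is a non-square and
(a) applies. -/

open Finset

/-- If `-1` is a power of `2` modulo `p`, then a binary function on `ℤ/p` with vanishing periodic
autocorrelation vanishes. -/
theorem eq_zero_of_autocorrelation_eq_zero {p k : ℕ} [NeZero p] (hk : 0 < k)
    (hneg : (2 : ZMod p) ^ k = -1) (u : ZMod p → ZMod 2)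
    (hu : ∀ j, ∑ i, u i * u (i + j) = 0) : u = 0 := by
  let s : ZMod p → AddMonoidAlgebra (ZMod 2) (ZMod p) := fun i => AddMonoidAlgebra.single i 1
  have hs : ∀ i j, s i * s j = s (i + j) := fun i j => by
    simp only [s, AddMonoidAlgebra.single_mul_single, one_mul]
  have hspow : ∀ (n : ℕ) i, s i ^ n = s (n * i) := fun n i => by
    simp only [s, AddMonoidAlgebra.single_pow, one_pow, nsmul_eq_mul]
  have : CharP (AddMonoidAlgebra (ZMod 2) (ZMod p)) 2 :=
    charP_of_injective_algebraMap' (ZMod 2) 2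
  have hfrob : ∀ n : ℕ, (∑ i, u i • s i) ^ 2 ^ n = ∑ i, u i • s (2 ^ n * i) := by
    intro n
    rw [sum_pow_char_pow]
    refine sum_congr rfl fun i _ => ?_
    rw [_root_.smul_pow, hspow, ZMod.pow_card_pow]
    push_cast
    rfl
  have hprod : (∑ i, u i • s i) * (∑ i, u i • s i) ^ 2 ^ k = 0 := by
    rw [hfrob, hneg, mul_comm, sum_mul_sum]
    calc ∑ i, ∑ j, u i • s (-1 * i) * u j • s j
        = ∑ i, ∑ j, (u i * u (i + j)) • s j := by
          refine sum_congr rfl fun i _ => ?_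
          rw [← Equiv.sum_comp (Equiv.addLeft i)]
          refine sum_congr rfl fun j _ => ?_
          rw [smul_mul_smul_comm, hs]
          simp [mul_comm]
      _ = 0 := by
          rw [sum_comm]
          simp_rw [← sum_smul, hu, zero_smul, sum_const_zero]
  -- Frobenius iterated `2k` times acts as `i ↦ (-1)² i`, so it fixes the element, whose `(1 + 2 ^
  -- k)`-th power is already zero.
  have hzero : (∑ i, u i • s i) = 0 := by
    have h1 : (∑ i, u i • s i) ^ 2 ^ (2 * k) = ∑ i, u i • s i := by
      rw [hfrob, mul_comm 2 k, pow_mul, hneg]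
      simp
    have h2 : 1 + 2 ^ k ≤ 2 ^ (2 * k) := by
      have : 2 ≤ 2 ^ k := by simpa using Nat.pow_le_pow_right (n := 2) (by norm_num) hk
      rw [two_mul, pow_add]
      nlinarith
    rw [← h1]
    refine pow_eq_zero_of_le h2 ?_
    rw [pow_add, pow_one, hprod]
  funext j
  have := congrArg (fun r => r.coeff j) hzero
  simpa [s, AddMonoidAlgebra.coeff_sum, Finsupp.single_apply] using this

theorem Finset.sum_range_two_mul {M : Type*} [AddCommMonoid M] (n : ℕ) (F : ℕ → M) :
    ∑ i ∈ range (2 * n), F i = ∑ i ∈ range n, F (2 * i) + ∑ i ∈ range n, F (2 * i + 1) := by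
  induction n with
  | zero => simp
  | succ n ih =>
    rw [mul_add, mul_one, sum_range_succ, sum_range_succ, ih, sum_range_succ, sum_range_succ]
    abel

/-! ### Cycle structure -/

/-- A permutation of `2 * p + 2` points of order `2 * p` whose involution has no fixed point
has a cycle of length `2 * p` and a cycle of length `2`. -/
theorem Equiv.Perm.exists_cycles_of_orderOf_eq_two_mul_prime {α : Type*} [Fintype α]
    [DecidableEq α] {p : ℕ} (hp : p.Prime) (hα : Fintype.card α = 2 * p + 2) (g : Equiv.Perm α)
    (hg : orderOf g = 2 * p) (hfix : ∀ i, (g ^ p) i ≠ i) :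
    ∃ x y, Set.InjOn (fun i => (g ^ i) x) (range (2 * p)) ∧ (∀ i : ℕ, (g ^ i) x ≠ y) ∧
      g (g y) = y ∧ ∀ {M : Type} [AddCommMonoid M] (F : α → M),
        ∑ i, F i = ∑ i ∈ range (2 * p), F ((g ^ i) x) + (F y + F (g y)) := by
  have hper : ∀ n x, Function.minimalPeriod g x ∣ n ↔ (g ^ n) x = x := fun n x => by
    rw [← Function.isPeriodicPt_iff_minimalPeriod_dvd, Function.IsPeriodicPt,
      Function.IsFixedPt, Equiv.Perm.iterate_eq_pow]
  have hcase : ∀ x, (g ^ 2) x = x ∨ Function.minimalPeriod g x = 2 * p := by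
    intro x
    have h1 : Function.minimalPeriod g x ∣ 2 * p := by
      rw [hper, ← hg, pow_orderOf_eq_one]; rfl
    obtain ⟨a, b, ha, hb, hab⟩ := exists_dvd_and_dvd_of_dvd_mul h1
    rcases (Nat.dvd_prime Nat.prime_two).1 ha with rfl | rfl
    · exact absurd ((hper p x).1 (by rw [hab, one_mul]; exact hb)) (hfix x)
    rcases (Nat.dvd_prime hp).1 hb with rfl | rfl
    · left; rw [← hper, hab, mul_one]
    · right; exact hab
  have hinj : ∀ x, Function.minimalPeriod g x = 2 * p →
      Set.InjOn (fun i => (g ^ i) x) (range (2 * p)) := by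
    intro x hx i hi j hj hij
    have hi' : i < 2 * p := by simpa using hi
    have hj' : j < 2 * p := by simpa using hj
    rw [← hx] at hi' hj'
    refine (Function.iterate_eq_iterate_iff_of_lt_minimalPeriod hi' hj').1 ?_
    simpa [Equiv.Perm.iterate_eq_pow] using hij
  obtain ⟨x, hx⟩ : ∃ x, Function.minimalPeriod g x = 2 * p := by
    by_contra! h
    have : orderOf g ∣ 2 := orderOf_dvd_of_pow_eq_one <| by
      ext x
      rw [(hcase x).resolve_right (h x)]; rfl
    rw [hg] at this
    have := Nat.le_of_dvd two_pos this
    have := hp.two_le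
    omega
  let O : α → Finset α := fun x =>
    (range (2 * p)).image fun i => (g ^ i) x
  have hcard : ∀ x, Function.minimalPeriod g x = 2 * p → #(O x) = 2 * p := fun x hx => by
    rw [card_image_of_injOn (hinj x hx), card_range]
  have hmem : ∀ x, Function.minimalPeriod g x = 2 * p → ∀ n : ℕ, (g ^ n) x ∈ O x := by
    intro x hx n
    refine mem_image.2 ⟨n % (2 * p), ?_, ?_⟩
    · exact mem_range.2 (Nat.mod_lt _ (by have := hp.pos; omega))
    · rw [← hg, pow_mod_orderOf]
  have hclosed : ∀ x, Function.minimalPeriod g x = 2 * p → ∀ z, ∀ n : ℕ,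
      (g ^ n) z ∈ O x → z ∈ O x := by
    intro x hx z n hz
    obtain ⟨i, -, hi⟩ := mem_image.1 hz
    -- `g ^ ((2p - 1) n)` is the inverse of `g ^ n`.
    have : z = (g ^ ((2 * p - 1) * n + i)) x := by
      rw [pow_add, Equiv.Perm.mul_apply, hi, ← Equiv.Perm.mul_apply, ← pow_add,
        show (2 * p - 1) * n + n = (2 * p) * n by
          rw [← Nat.succ_mul]; congr 1; have := hp.pos; omega,
        pow_mul, ← hg, pow_orderOf_eq_one, one_pow]
      rfl
    rw [this]
    exact hmem x hx _
  have hcompl : #(O x)ᶜ = 2 := by rw [card_compl, hcard x hx, hα]; omega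
  obtain ⟨y, hy⟩ : (O x)ᶜ.Nonempty := card_pos.1 (by omega)
  have hy' : y ∉ O x := by simpa using hy
  have hy2 : (g ^ 2) y = y := by
    refine (hcase y).resolve_right fun h => ?_
    have hsub : O y ⊆ (O x)ᶜ := by
      intro z hz
      obtain ⟨i, -, rfl⟩ := mem_image.1 hz
      exact mem_compl.2 fun h' => hy' (hclosed x hx y i h')
    have := card_le_card hsub
    rw [hcard y h, hcompl] at this
    have := hp.two_le
    omega
  have hgy : g y ≠ y := by
    intro h
    exact hfix y (Equiv.Perm.pow_apply_eq_self_of_apply_eq_self h p)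
  have hgy' : g y ∈ (O x)ᶜ := mem_compl.2 fun h => hy' (hclosed x hx y 1 (by simpa using h))
  have hset : (O x)ᶜ = {y, g y} := by
    symm
    refine eq_of_subset_of_card_le ?_ ?_
    · intro z hz
      rcases mem_insert.1 hz with rfl | hz
      · exact hy
      · rw [mem_singleton.1 hz]; exact hgy'
    · rw [hcompl, card_pair hgy.symm]
  refine ⟨x, y, hinj x hx, fun i h => hy' (h ▸ hmem x hx i),
    by simpa [pow_two] using hy2, fun F => ?_⟩
  rw [← sum_add_sum_compl (O x), hset, sum_pair hgy.symm, sum_image (hinj x hx)]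

/-! ### The order of 2 modulo p -/

theorem exists_two_pow_eq_neg_one_of_even_orderOfTwo {p : ℕ} (hp : p.Prime) (hodd : Odd p)
    (he : Even (orderOfTwo p)) : ∃ k, 0 < k ∧ (2 : ZMod p) ^ k = -1 := by
  have := Fact.mk hp
  have hiff : ∀ s, p ∣ 2 ^ s - 1 ↔ (2 : ZMod p) ^ s = 1 := fun s => by
    rw [← ZMod.natCast_eq_zero_iff, Nat.cast_sub Nat.one_le_two_pow]
    push_cast
    rw [sub_eq_zero]
  have h2 : (2 : ZMod p) ≠ 0 := by
    intro h
    have : p ∣ 2 := (ZMod.natCast_eq_zero_iff 2 p).1 (by exact_mod_cast h)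
    rcases (Nat.dvd_prime Nat.prime_two).1 this with rfl | rfl
    · exact hp.one_lt.false
    · exact absurd hodd (by decide)
  have hne : {s | 0 < s ∧ p ∣ 2 ^ s - 1}.Nonempty :=
    ⟨p - 1, Nat.sub_pos_of_lt hp.one_lt, (hiff _).2 (ZMod.pow_card_sub_one_eq_one h2)⟩
  obtain ⟨hpos, hdvd⟩ := Nat.sInf_mem hne
  change 0 < orderOfTwo p at hpos
  change p ∣ 2 ^ orderOfTwo p - 1 at hdvd
  obtain ⟨k, hk⟩ := he
  refine ⟨k, by omega, ?_⟩
  rw [hiff, hk, pow_add] at hdvd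
  refine (mul_self_eq_one_iff.1 hdvd).resolve_left fun h => ?_
  have : orderOfTwo p ≤ k := Nat.sInf_le ⟨by omega, (hiff k).2 h⟩
  omega

/-- An odd order `2m + 1` would give `2 = (2 ^ (m + 1))²`, but `2` is a square only for `p ≡ ±1`
modulo `8`. -/
theorem even_orderOfTwo_of_mod_eight_eq_three {p : ℕ} (hp : p.Prime) (h8 : p % 8 = 3) :
    Even (orderOfTwo p) := by
  have := Fact.mk hp
  by_contra h
  obtain ⟨m, hm⟩ := Nat.not_even_iff_odd.1 h
  have hdvd : p ∣ 2 ^ orderOfTwo p - 1 := by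
    -- On the empty set `sInf` would be `0`, which is not odd.
    have hne : {s | 0 < s ∧ p ∣ 2 ^ s - 1}.Nonempty := by
      by_contra hne
      rw [Set.not_nonempty_iff_eq_empty] at hne
      rw [orderOfTwo, hne, Nat.sInf_empty] at hm
      omega
    exact (Nat.sInf_mem hne).2
  rw [← ZMod.natCast_eq_zero_iff, Nat.cast_sub Nat.one_le_two_pow] at hdvd
  push_cast at hdvd
  rw [sub_eq_zero, hm] at hdvd
  have hsq : IsSquare (2 : ZMod p) := ⟨2 ^ (m + 1), by
    calc (2 : ZMod p) = 2 ^ (2 * m + 1) * 2 := by rw [hdvd, one_mul]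
      _ = _ := by ring⟩
  rw [ZMod.exists_sq_eq_two_iff (by rintro rfl; omega)] at hsq
  omega

/-! ### Codewords forced by self-duality -/

namespace BinaryCode

theorem mem_iff_of_isSelfDual {n : ℕ} {C : BinaryCode n} (hC : C.IsSelfDual) (v : Fin n → ZMod 2) :
    v ∈ C ↔ ∀ c ∈ C, v ⬝ᵥ c = 0 := by
  conv_lhs => rw [hC]
  rfl

theorem comp_pow_mem {n : ℕ} {C : BinaryCode n} {g : Equiv.Perm (Fin n)} (hg : g ∈ C.aut) (m : ℕ)
    {c : Fin n → ZMod 2} (hc : c ∈ C) : c ∘ ⇑(g ^ m) ∈ C :=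
  ((pow_mem hg m : g ^ m ∈ C.aut) c).2 hc

theorem minDist_le_hammingNorm {n : ℕ} {C : BinaryCode n} {w : Fin n → ZMod 2} (hw : w ∈ C)
    (h0 : w ≠ 0) : C.minDist ≤ hammingNorm w :=
  Nat.sInf_le ⟨w, hw, 0, C.zero_mem, h0, hammingDist_zero_right w⟩

/-- The codewords of a self-dual code satisfy `(g ^ p - 1) (g ^ 2 - 1) c = 0` on a `2p`-cycle of an
automorphism `g` whose remaining points lie on cycles of length dividing `2`, as soon as `-1` is a
power of `2` modulo `p`. -/
theorem add_comp_pow_eq_zero_of_two_pow_eq_neg_one {p k n : ℕ} [NeZero p] {C : BinaryCode n}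
    (hC : C.IsSelfDual) {g : Equiv.Perm (Fin n)} (hgC : g ∈ C.aut) (hg : g ^ (2 * p) = 1)
    {x y : Fin n} (hy : g (g y) = y)
    (hsum : ∀ F : Fin n → ZMod 2,
      ∑ i, F i = ∑ i ∈ range (2 * p), F ((g ^ i) x) + (F y + F (g y)))
    (hk : 0 < k) (hneg : (2 : ZMod p) ^ k = -1) {c : Fin n → ZMod 2} (hc : c ∈ C) :
    c x + c ((g ^ 2) x) + (c ((g ^ p) x) + c ((g ^ (p + 2)) x)) = 0 := by
  let d : Fin n → ZMod 2 := c + c ∘ ⇑(g ^ 2)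
  have hd : d ∈ C := C.add_mem hc (comp_pow_mem hgC 2 hc)
  have hdy : d y = 0 := by
    simp only [d, Pi.add_apply, Function.comp_apply, pow_two, Equiv.Perm.mul_apply, hy]
    exact CharTwo.add_self_eq_zero _
  have hdgy : d (g y) = 0 := by
    simp only [d, Pi.add_apply, Function.comp_apply, pow_two, Equiv.Perm.mul_apply, hy]
    exact CharTwo.add_self_eq_zero _
  let a : ℕ → ZMod 2 := fun m => d ((g ^ m) x)
  have ha : ∀ m, a (m + 2 * p) = a m := fun m => by simp [a, pow_add, hg]
  have hcorr : ∀ j, ∑ i ∈ range (2 * p), a i * a (i + j) = 0 := by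
    intro j
    have h := (mem_iff_of_isSelfDual hC d).1 hd _ (comp_pow_mem hgC j hd)
    rw [dotProduct, hsum, hdy, hdgy, zero_mul, zero_mul, add_zero, add_zero] at h
    rw [← h]
    refine sum_congr rfl fun i _ => ?_
    simp only [a, Function.comp_apply, ← Equiv.Perm.mul_apply, ← pow_add, add_comm j i]
  -- Folding the `2p`-cycle onto `ℤ/p` preserves the vanishing of the autocorrelation.
  let U : ℕ → ZMod 2 := fun m => a m + a (m + p)
  have hU : Function.Periodic U p := fun m => by
    simp only [U]
    rw [add_assoc m p p, ← two_mul, ha, add_comm]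
  have hUcorr : ∀ j, ∑ i ∈ range p, U i * U (i + j) = 0 := by
    intro j
    have h : ∑ i ∈ range (2 * p), a i * U (i + j) = 0 := by
      simp only [U, mul_add, sum_add_distrib, add_assoc, hcorr, add_zero]
    rw [two_mul, sum_range_add] at h
    rw [← h, ← sum_add_distrib]
    refine sum_congr rfl fun i _ => ?_
    rw [show p + i + j = i + j + p by ring, hU (i + j), add_comm p i, ← add_mul]
  let u : ZMod p → ZMod 2 := fun i => U i.val
  have hu : ∀ m : ℕ, u m = U m := fun m => by
    simp only [u, ZMod.val_natCast]
    exact hU.map_mod_nat m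
  have hu0 : u = 0 := by
    refine eq_zero_of_autocorrelation_eq_zero hk hneg u fun j => ?_
    rw [← hUcorr j.val]
    refine sum_nbij' (fun i => i.val) (fun i => (i : ZMod p)) ?_ ?_ ?_ ?_ ?_
    · intro i _; exact mem_range.2 (ZMod.val_lt i)
    · intro i _; exact mem_univ _
    · intro i _; simp
    · intro i hi; exact ZMod.val_cast_of_lt (mem_range.1 hi)
    · intro i _
      rw [← hu, ← hu]
      simp
  have := hu 0
  rw [hu0] at this
  simp only [Pi.zero_apply, U, a, d, Pi.add_apply, Function.comp_apply, zero_add, pow_zero,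
    Equiv.Perm.one_apply, ← Equiv.Perm.mul_apply, ← pow_add] at this
  rw [this, add_comm p 2]

/-- A doubly even self-dual code with an automorphism consisting of a `2p`-cycle and a `2`-cycle
has `p ≢ 1` modulo `4`. -/
theorem mod_four_ne_one_of_isDoublyEven {p n : ℕ} {C : BinaryCode n}
    (hC : C.IsSelfDual) (hCe : C.IsDoublyEven) {g : Equiv.Perm (Fin n)} (hgC : g ∈ C.aut)
    (hg : g ^ (2 * p) = 1) {x y : Fin n} (hinj : Set.InjOn (fun i => (g ^ i) x) (range (2 * p)))
    (hxy : ∀ i : ℕ, (g ^ i) x ≠ y) (hy : g (g y) = y)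
    (hsum : ∀ {M : Type} [AddCommMonoid M] (F : Fin n → M),
      ∑ i, F i = ∑ i ∈ range (2 * p), F ((g ^ i) x) + (F y + F (g y))) : p % 4 ≠ 1 := by
  intro hp
  have hp2 : (p : ZMod 2) = 1 := by
    rw [ZMod.natCast_eq_one_iff_odd, Nat.odd_iff]; omega
  have hkey : ∀ c ∈ C, ∑ i ∈ range p, c ((g ^ (2 * i)) x) + c y = 0 := by
    intro c hc
    let e : Fin n → ZMod 2 := ∑ i ∈ range p, c ∘ ⇑(g ^ (2 * i))
    have he : e ∈ C := C.sum_mem fun i _ => comp_pow_mem hgC _ hc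
    have happ : ∀ z, e z = ∑ i ∈ range p, c ((g ^ (2 * i)) z) := fun z => by simp [e]
    have hinv : ∀ z, e ((g ^ 2) z) = e z := by
      intro z
      -- Peel `p + 1` terms at either end: the extreme terms agree because `g ^ (2p) = 1`.
      have h := (sum_range_succ (fun i => c ((g ^ (2 * i)) z)) p).symm.trans
        (sum_range_succ' (fun i => c ((g ^ (2 * i)) z)) p)
      rw [hg, mul_zero, pow_zero] at h
      rw [happ, happ, add_right_cancel h]
      simp only [mul_add, mul_one, pow_add, Equiv.Perm.mul_apply]
    have hinv' : ∀ z, ∀ j : ℕ, e ((g ^ (2 * j)) z) = e z := by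
      intro z j
      induction j with
      | zero => simp
      | succ j ih => rw [mul_add, mul_one, add_comm, pow_add, Equiv.Perm.mul_apply, hinv, ih]
    have hey : e y = c y := by
      have h2 : ∀ i : ℕ, (g ^ (2 * i)) y = y := fun i => by
        rw [pow_mul]
        exact Equiv.Perm.pow_apply_eq_self_of_apply_eq_self (by simpa [pow_two] using hy) i
      rw [happ]
      simp [h2, hp2]
    rw [← happ, ← hey]
    have hwt := hCe e he
    rw [hammingNorm, card_filter, hsum, Finset.sum_range_two_mul] at hwt
    simp only [hinv', pow_succ, Equiv.Perm.mul_apply, sum_const, card_range, smul_eq_mul] at hwt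
    have hbin : ∀ a : ZMod 2, a = 0 ∨ a = 1 := by decide
    obtain ⟨m, hm⟩ : ∃ m, p = 4 * m + 1 := ⟨p / 4, by omega⟩
    -- The weight is `p` times two bits plus two more bits; as `p ≡ 1` modulo `4`, the four bits sum
    -- to `0` modulo `4` and so are all equal.
    rcases hbin (e x) with h1 | h1 <;> rcases hbin (e (g x)) with h2 | h2 <;>
      rcases hbin (e y) with h3 | h3 <;> rcases hbin (e (g y)) with h4 | h4 <;>
      simp only [h1, h2, h3, h4, ne_eq, not_true_eq_false, one_ne_zero, not_false_eq_true,
        if_true, if_false] at hwt ⊢ <;>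
      first
        | rfl
        | (exfalso; omega)
  let S : Finset (Fin n) := (range p).image fun i => (g ^ (2 * i)) x
  have hinj2 : Set.InjOn (fun i => (g ^ (2 * i)) x) (range p) := by
    intro i hi j hj hij
    have hi' := mem_range.1 (mem_coe.1 hi)
    have hj' := mem_range.1 (mem_coe.1 hj)
    have : 2 * i = 2 * j := hinj (mem_coe.2 (mem_range.2 (by omega)))
      (mem_coe.2 (mem_range.2 (by omega))) hij
    omega
  have hyS : y ∉ S := by
    intro h
    obtain ⟨i, -, hi⟩ := mem_image.1 h
    exact hxy _ hi
  let v : Fin n → ZMod 2 := fun i => if i ∈ insert y S then 1 else 0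
  have hv : v ∈ C := by
    rw [mem_iff_of_isSelfDual hC]
    intro c hc
    have : v ⬝ᵥ c = ∑ i ∈ insert y S, c i := by
      simp only [dotProduct, v, ite_mul, one_mul, zero_mul, sum_ite_mem, univ_inter]
    rw [this, sum_insert hyS, sum_image hinj2, add_comm]
    exact hkey c hc
  have hwt : hammingNorm v = p + 1 := by
    have : hammingNorm v = #(insert y S) := by
      rw [hammingNorm]
      congr 1
      ext i
      rw [mem_filter]
      by_cases h : i ∈ insert y S <;> simp only [v, h] <;> simp
    rw [this, card_insert_of_notMem hyS, card_image_of_injOn hinj2, card_range]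
  have := hCe v hv
  omega

end BinaryCode

/-! ### The two statements -/

theorem mainTheorem7 (p : ℕ) (hp : p.Prime) (hodd : Odd p) (C : BinaryCode (2 * p + 2))
    (hC : C.IsSelfDual) (hd : 4 < C.minDist)
    (hinv : ∀ σ ∈ C.aut, orderOf σ = 2 → ∀ i, σ i ≠ i) :
    (Even (orderOfTwo p) → ¬ ∃ g ∈ C.aut, orderOf g = 2 * p) ∧
    (C.IsDoublyEven → ¬ ((p : ℤ) ≡ -1 [ZMOD 8]) → ¬ ∃ g ∈ C.aut, orderOf g = 2 * p) := by
  have : NeZero p := ⟨hp.ne_zero⟩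
  have hfix : ∀ g ∈ C.aut, orderOf g = 2 * p → ∀ i, (g ^ p) i ≠ i := by
    intro g hgC hg
    refine hinv _ (pow_mem hgC p) ?_
    rw [orderOf_pow_of_dvd hp.ne_zero (by rw [hg]; exact dvd_mul_left p 2), hg,
      Nat.mul_div_cancel _ hp.pos]
  have hone : ∀ g : Equiv.Perm (Fin (2 * p + 2)), orderOf g = 2 * p → g ^ (2 * p) = 1 :=
    fun g hg => orderOf_dvd_iff_pow_eq_one.1 (dvd_of_eq hg)
  have hA : Even (orderOfTwo p) → ¬ ∃ g ∈ C.aut, orderOf g = 2 * p := by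
    rintro he ⟨g, hgC, hg⟩
    obtain ⟨k, hk, hneg⟩ := exists_two_pow_eq_neg_one_of_even_orderOfTwo hp hodd he
    obtain ⟨x, y, hinj, -, hy, hsum⟩ :=
      Equiv.Perm.exists_cycles_of_orderOf_eq_two_mul_prime hp (Fintype.card_fin _) g hg
        (hfix g hgC hg)
    -- Ensures `p + 2 < 2p`, so the exponents `0, 2, p, p + 2` stay within one period.
    have hp3 : 2 < p := by
      have := hp.two_le
      obtain ⟨m, hm⟩ := hodd
      omega
    let w : Fin (2 * p + 2) → ZMod 2 := Pi.single x 1 + Pi.single ((g ^ 2) x) 1 +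
      (Pi.single ((g ^ p) x) 1 + Pi.single ((g ^ (p + 2)) x) 1)
    have hw : w ∈ C := by
      rw [BinaryCode.mem_iff_of_isSelfDual hC]
      intro c hc
      simp only [w, add_dotProduct, single_one_dotProduct]
      exact BinaryCode.add_comp_pow_eq_zero_of_two_pow_eq_neg_one hC hgC
        (hone g hg) hy (fun F => hsum F) hk hneg hc
    have hne : ∀ i j, i < 2 * p → j < 2 * p → i ≠ j → (g ^ i) x ≠ (g ^ j) x :=
      fun i j hi hj hij h => hij (hinj (by simpa using hi) (by simpa using hj) h)
    have h02 : x ≠ (g ^ 2) x := hne 0 2 (by omega) (by omega) (by omega)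
    have h0p : x ≠ (g ^ p) x := hne 0 p (by omega) (by omega) (by omega)
    have h0q : x ≠ (g ^ (p + 2)) x := hne 0 (p + 2) (by omega) (by omega) (by omega)
    have hw0 : w ≠ 0 := by
      intro h
      have := congrFun h x
      simp [w, h02, h0p, h0q] at this
    have hwt : hammingNorm w ≤ 4 := by
      have hsub : ({i | w i ≠ 0} : Finset _) ⊆ {x, (g ^ 2) x, (g ^ p) x, (g ^ (p + 2)) x} := by
        intro i hi
        by_contra hi'
        simp only [mem_insert, mem_singleton, not_or] at hi'
        obtain ⟨h1, h2, h3, h4⟩ := hi'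
        simp [w, h1, h2, h3, h4] at hi
      exact (card_le_card hsub).trans card_le_four
    exact absurd (BinaryCode.minDist_le_hammingNorm hw hw0) (by omega)
  refine ⟨hA, fun hCe h8 => ?_⟩
  rintro ⟨g, hgC, hg⟩
  obtain ⟨x, y, hinj, hxy, hy, hsum⟩ :=
    Equiv.Perm.exists_cycles_of_orderOf_eq_two_mul_prime hp (Fintype.card_fin _) g hg
        (hfix g hgC hg)
  have h4 := BinaryCode.mod_four_ne_one_of_isDoublyEven hC hCe hgC
    (hone g hg) hinj hxy hy hsum
  have h3 : p % 8 = 3 := by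
    obtain ⟨m, hm⟩ := hodd
    have : p % 8 ≠ 7 := fun h => h8 (by rw [Int.ModEq]; omega)
    omega
  exact hA (even_orderOfTwo_of_mod_eight_eq_three hp h3) ⟨g, hgC, hg⟩
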